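/- Let $\mathcal H$ and $\mathcal K$ be finite-dimensional complex Hilbert spaces with $N=\dim\mathcal H\ge 1$, and let $U$ be a unitary operator on $\mathcal H\otimes\mathcal K$. For an operator $X$ on $\mathcal K$ put $$\mathcal L(X)=\operatorname{Tr}_{\mathcal H}\!\left[U\left(\tfrac1N I_{\mathcal H}\otimes X\right)U^*\right],$$ where $\operatorname{Tr}_{\mathcal H}$ denotes the partial trace over $\mathcal H$, and for a density matrix $\omega$ on $\mathcal K$ (a positive semidefinite operator of trace one) let $S(\omega)=-\operatorname{Tr}[\omega\log\omega]$ be its von Neumann entropy, with the convention $0\log 0=0$. Then for every density matrix $\omega$ on $\mathcal K$, $$S(\omega)\le S(\mathcal L(\omega)),$$ and equality holds if and only if $$U\left(\tfrac1N I_{\mathcal H}\otimes\omega\right)U^*=\tfrac1N I_{\mathcal H}\otimes\mathcal L(\omega).$$ -/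

import Mathlib

open scoped Kronecker ComplexOrder

noncomputable section

/-- A density matrix: a positive semidefinite matrix of trace one. -/
def IsDensityMatrix {κ : Type*} [Fintype κ] (ω : Matrix κ κ ℂ) : Prop :=
  ω.PosSemidef ∧ ω.trace = 1

/-- The partial trace over the first tensor factor, `Tr_H : B(H ⊗ K) → B(K)`, where
`H = ℂ^ι`, `K = ℂ^κ` and `H ⊗ K = ℂ^(ι × κ)`. -/
def partialTraceFst {ι κ : Type*} [Fintype ι] (M : Matrix (ι × κ) (ι × κ) ℂ) : Matrix κ κ ℂ :=
  Matrix.of fun k l => ∑ i, M (i, k) (i, l)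

/-- The operator `(1/N) I_H ⊗ X` on `H ⊗ K`, with `N = dim H`. -/
def maxMixedTensor (ι : Type*) {κ : Type*} [Fintype ι] [DecidableEq ι] (X : Matrix κ κ ℂ) :
    Matrix (ι × κ) (ι × κ) ℂ :=
  ((1 / (Fintype.card ι : ℂ)) • (1 : Matrix ι ι ℂ)) ⊗ₖ X

/-- The map `L(X) = Tr_H [U ((1/N) I_H ⊗ X) U*]` on `B(K)`. -/
def environmentMap {ι κ : Type*} [Fintype ι] [DecidableEq ι] [Fintype κ]
    (U : Matrix (ι × κ) (ι × κ) ℂ) (X : Matrix κ κ ℂ) : Matrix κ κ ℂ :=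
  partialTraceFst (U * maxMixedTensor ι X * U.conjTranspose)

/-- The von Neumann entropy `S(ω) = -Tr [φ(ω)]`, where `φ(x) = x log x` (so `φ(0) = 0`) is applied
to the matrix `ω` by functional calculus. -/
def vonNeumannEntropy {κ : Type*} [Fintype κ] [DecidableEq κ] (ω : Matrix κ κ ℂ) : ℝ :=
  -(Matrix.trace (cfc (fun x : ℝ => x * Real.log x) ω)).re

end


/-!
Let `N = dim H`, let `f` be strictly concave, and let `σ = (1/N) Tr_H M` for a Hermitian `M` on
`H ⊗ K`. In a product basis whose second factor diagonalizes `σ`, the diagonal entries of `M` are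
averages of its eigenvalues with doubly stochastic weights, so Jensen's inequality bounds `Tr f(M)`
by the sum of `f` over the diagonal of `M`, with equality only if `M` is diagonal (Peierls). The
diagonal entries of `M` average over `H` to the eigenvalues of `σ`, so a second use of Jensen's
inequality gives `Tr f(M) ≤ N Tr f(σ)`, with equality if and only if `M = 1 ⊗ σ`. For
`M = U (1 ⊗ X) U*` one has `Tr f(M) = N Tr f(X)` and `σ = L(X)`; the entropy is the case
`f(x) = -x log x`. Working with `1 ⊗ X` instead of `(1/N) 1 ⊗ X` avoids rescaling the argument
of `f`.
-/

open Matrix Finset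

section Jensen

variable {s : Set ℝ} {f : ℝ → ℝ}

lemma sum_le_sum_mulVec_of_doublyStochastic {n : Type*} [Fintype n] [DecidableEq n]
    (hf : StrictConcaveOn ℝ s f) {B : Matrix n n ℝ} (hB : B ∈ doublyStochastic ℝ n)
    {p : n → ℝ} (hp : ∀ x, p x ∈ s) :
    ∑ x, f (p x) ≤ ∑ y, f ((B *ᵥ p) y) ∧
      (∑ x, f (p x) = ∑ y, f ((B *ᵥ p) y) ↔ ∀ y x, B y x ≠ 0 → p x = (B *ᵥ p) y) := by
  have sum_eq : ∑ x, f (p x) = ∑ y, ∑ x, B y x • f (p x) := by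
    rw [sum_comm]
    simp only [← sum_smul, sum_col_of_mem_doublyStochastic hB, one_smul]
  have mulVec_eq (y : n) : (B *ᵥ p) y = ∑ x, B y x • p x := rfl
  have jensen (y : n) : ∑ x, B y x • f (p x) ≤ f ((B *ᵥ p) y) :=
    hf.concaveOn.le_map_sum (fun _ _ ↦ hB.1 _ _) (sum_row_of_mem_doublyStochastic hB y)
      fun x _ ↦ hp x
  have jensen_eq (y : n) :
      ∑ x, B y x • f (p x) = f ((B *ᵥ p) y) ↔ ∀ x, B y x ≠ 0 → p x = (B *ᵥ p) y := by
    rw [eq_comm]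
    simpa only [mem_univ, true_imp_iff, mulVec_eq] using
      hf.map_sum_eq_iff' (t := univ) (fun _ _ ↦ hB.1 _ _) (sum_row_of_mem_doublyStochastic hB y)
        fun x _ ↦ hp x
  rw [sum_eq, sum_eq_sum_iff_of_le fun y _ ↦ jensen y]
  exact ⟨sum_le_sum fun y _ ↦ jensen y, by simp only [mem_univ, true_imp_iff, jensen_eq]⟩

lemma sum_le_card_mul_sum_map_average {ι κ : Type*} [Fintype ι] [Nonempty ι] [Fintype κ]
    (hf : StrictConcaveOn ℝ s f) {d : ι × κ → ℝ} (hd : ∀ x, d x ∈ s) {q : κ → ℝ}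
    (hq : ∀ k, q k = (Fintype.card ι : ℝ)⁻¹ * ∑ i, d (i, k)) :
    ∑ x, f (d x) ≤ Fintype.card ι * ∑ k, f (q k) ∧
      (∑ x, f (d x) = Fintype.card ι * ∑ k, f (q k) ↔ ∀ i k, d (i, k) = q k) := by
  have hN : (0 : ℝ) < Fintype.card ι := by exact_mod_cast Fintype.card_pos
  have weights : ∑ _i : ι, (Fintype.card ι : ℝ)⁻¹ = 1 := by simp
  have average_f (k : κ) : ∑ i, (Fintype.card ι : ℝ)⁻¹ • f (d (i, k)) =
      (Fintype.card ι : ℝ)⁻¹ * ∑ i, f (d (i, k)) := by simp only [smul_eq_mul, mul_sum]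
  have average_d (k : κ) : ∑ i, (Fintype.card ι : ℝ)⁻¹ • d (i, k) = q k := by
    simp only [smul_eq_mul, ← mul_sum, hq]
  have jensen (k : κ) : ∑ i, f (d (i, k)) ≤ Fintype.card ι * f (q k) := by
    rw [← inv_mul_le_iff₀ hN, ← average_f, ← average_d]
    exact hf.concaveOn.le_map_sum (fun _ _ ↦ by positivity) weights fun i _ ↦ hd (i, k)
  have jensen_eq (k : κ) :
      ∑ i, f (d (i, k)) = Fintype.card ι * f (q k) ↔ ∀ i, d (i, k) = q k := by
    rw [← inv_mul_eq_iff_eq_mul₀ hN.ne', ← average_f, ← average_d, eq_comm]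
    simpa only [mem_univ, true_imp_iff] using
      hf.map_sum_eq_iff (t := univ) (fun _ _ ↦ by positivity) weights fun i _ ↦ hd (i, k)
  rw [Fintype.sum_prod_type_right, mul_sum, sum_eq_sum_iff_of_le fun k _ ↦ jensen k,
    forall_comm (α := ι)]
  exact ⟨sum_le_sum fun k _ ↦ jensen k, by simp only [mem_univ, true_imp_iff, jensen_eq]⟩

end Jensen

section TraceFunction

variable {𝕜 n : Type*} [RCLike 𝕜] [Fintype n] [DecidableEq n]

/-- The unistochastic matrix `(‖U y x‖²)` of a square matrix `U`; it is doubly stochastic when `U`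
is unitary. -/
def unistochastic (U : Matrix n n 𝕜) : Matrix n n ℝ :=
  U.map (‖·‖ ^ 2)

lemma unistochastic_mem_doublyStochastic (U : unitary (Matrix n n 𝕜)) :
    unistochastic (U : Matrix n n 𝕜) ∈ doublyStochastic ℝ n := by
  have sum_row (V : unitary (Matrix n n 𝕜)) (y : n) : ∑ x, ‖(V : Matrix n n 𝕜) y x‖ ^ 2 = 1 := by
    have h := congr_fun₂ (Unitary.coe_mul_star_self V) y y
    rw [Matrix.mul_apply, one_apply_eq] at h
    simp only [Unitary.coe_star, star_apply, RCLike.star_def, RCLike.mul_conj] at h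
    exact_mod_cast h
  refine mem_doublyStochastic_iff_sum.2 ⟨fun _ _ ↦ sq_nonneg _, sum_row U, fun x ↦ ?_⟩
  simpa [unistochastic, star_apply] using sum_row (star U) x

/-- The trace function `A ↦ Tr f(A)`, with `f` applied by functional calculus. Its real part is
taken so that it is real-valued by definition; for Hermitian `A` nothing is lost. -/
noncomputable def traceCfc (f : ℝ → ℝ) (A : Matrix n n 𝕜) : ℝ :=
  RCLike.re (cfc f A).trace

lemma traceCfc_eq_sum_eigenvalues (f : ℝ → ℝ) {A : Matrix n n 𝕜} (hA : A.IsHermitian) :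
    traceCfc f A = ∑ x, f (hA.eigenvalues x) := by
  rw [traceCfc, hA.cfc_eq, IsHermitian.cfc, Unitary.conjStarAlgAut_apply, trace_mul_cycle,
    Unitary.coe_star_mul_self, one_mul, trace_diagonal]
  simp

lemma map_cfc_of_isHermitian {m : Type*} [Fintype m] [DecidableEq m]
    (φ : Matrix m m 𝕜 →⋆ₐ[𝕜] Matrix n n 𝕜) (f : ℝ → ℝ) {A : Matrix m m 𝕜} (hA : A.IsHermitian) :
    φ (cfc f A) = cfc f (φ A) :=
  φ.map_cfc f A (A.finite_real_spectrum.continuousOn f)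
    (φ.toAlgHom.toLinearMap.continuous_of_finiteDimensional) hA (hA.isSelfAdjoint.map φ)

lemma traceCfc_conj (U : unitary (Matrix n n 𝕜)) (f : ℝ → ℝ) {A : Matrix n n 𝕜}
    (hA : A.IsHermitian) : traceCfc f (Unitary.conjStarAlgAut 𝕜 _ U A) = traceCfc f A := by
  have conj_cfc :
      Unitary.conjStarAlgAut 𝕜 _ U (cfc f A) = cfc f (Unitary.conjStarAlgAut 𝕜 _ U A) :=
    map_cfc_of_isHermitian (Unitary.conjStarAlgAut 𝕜 (Matrix n n 𝕜) U).toStarAlgHom f hA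
  rw [traceCfc, ← conj_cfc, Unitary.conjStarAlgAut_apply, trace_mul_cycle,
    Unitary.coe_star_mul_self, one_mul, traceCfc]

variable {A : Matrix n n 𝕜} {s : Set ℝ}

lemma spectrum_subset_Ici_of_posSemidef (hA : A.PosSemidef) : spectrum ℝ A ⊆ Set.Ici 0 := by
  rw [hA.isHermitian.spectrum_real_eq_range_eigenvalues]
  exact Set.range_subset_iff.2 hA.eigenvalues_nonneg

lemma re_diag_eq_unistochastic_mulVec_eigenvalues (hA : A.IsHermitian) (y : n) :
    RCLike.re (A y y) =
      (unistochastic (hA.eigenvectorUnitary : Matrix n n 𝕜) *ᵥ hA.eigenvalues) y := by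
  conv_lhs => rw [hA.spectral_theorem, Unitary.conjStarAlgAut_apply]
  rw [Matrix.mul_apply]
  simp only [mul_diagonal, star_apply, RCLike.star_def, mulVec, dotProduct, map_sum,
    unistochastic, map_apply, Function.comp_apply, mul_right_comm _ (_ : 𝕜) (starRingEnd 𝕜 _),
    RCLike.mul_conj]
  norm_cast

lemma re_diag_mem_of_spectrum_subset (hs : Convex ℝ s) (hA : A.IsHermitian)
    (hAs : spectrum ℝ A ⊆ s) (y : n) : RCLike.re (A y y) ∈ s := by
  have hB := unistochastic_mem_doublyStochastic hA.eigenvectorUnitary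
  rw [re_diag_eq_unistochastic_mulVec_eigenvalues hA]
  exact hs.sum_mem (fun _ _ ↦ hB.1 _ _) (sum_row_of_mem_doublyStochastic hB y)
    fun x _ ↦ hAs (hA.eigenvalues_mem_spectrum_real x)

lemma eigenvalues_eq_re_diag_iff (hA : A.IsHermitian) :
    (∀ y x, (hA.eigenvectorUnitary : Matrix n n 𝕜) y x ≠ 0 →
      hA.eigenvalues x = RCLike.re (A y y)) ↔ A = diagonal fun y ↦ (RCLike.re (A y y) : 𝕜) := by
  set V := hA.eigenvectorUnitary
  have eigen_eq : A * (V : Matrix n n 𝕜) =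
      (V : Matrix n n 𝕜) * diagonal (RCLike.ofReal ∘ hA.eigenvalues) := by
    conv_lhs => rw [hA.spectral_theorem, Unitary.conjStarAlgAut_apply]
    rw [mul_assoc, Unitary.coe_star_mul_self, mul_one]
  rw [← (Unitary.toUnits V).isUnit.mul_left_inj, Unitary.val_toUnits_apply, eigen_eq,
    ← Matrix.ext_iff]
  refine forall₂_congr fun y x ↦ ?_
  rw [mul_diagonal, diagonal_mul, mul_comm, mul_eq_mul_right_iff, Function.comp_apply,
    RCLike.ofReal_inj]
  tauto

lemma traceCfc_le_sum_re_diag {f : ℝ → ℝ} (hf : StrictConcaveOn ℝ s f) (hA : A.IsHermitian)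
    (hAs : spectrum ℝ A ⊆ s) :
    traceCfc f A ≤ ∑ y, f (RCLike.re (A y y)) ∧
      (traceCfc f A = ∑ y, f (RCLike.re (A y y)) ↔
        A = diagonal fun y ↦ (RCLike.re (A y y) : 𝕜)) := by
  have h := sum_le_sum_mulVec_of_doublyStochastic hf
    (unistochastic_mem_doublyStochastic hA.eigenvectorUnitary)
    fun x ↦ hAs (hA.eigenvalues_mem_spectrum_real x)
  simp only [← re_diag_eq_unistochastic_mulVec_eigenvalues hA,
    ← traceCfc_eq_sum_eigenvalues f hA] at h
  rw [← eigenvalues_eq_re_diag_iff hA]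
  simpa only [unistochastic, map_apply, ne_eq, OfNat.ofNat_ne_zero, not_false_eq_true,
    pow_eq_zero_iff, norm_eq_zero] using h

end TraceFunction

section Amplify

variable {R ι κ : Type*} [CommRing R] [StarRing R] [Fintype ι] [DecidableEq ι] [Fintype κ]
  [DecidableEq κ]

/-- The amplification `X ↦ 1 ⊗ X`, embedding the operators on the second tensor factor as a
`⋆`-subalgebra. -/
def amplify (ι : Type*) [Fintype ι] [DecidableEq ι] :
    Matrix κ κ R →⋆ₐ[R] Matrix (ι × κ) (ι × κ) R where
  toFun X := (1 : Matrix ι ι R) ⊗ₖ X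
  map_one' := one_kronecker_one
  map_mul' X Y := by rw [← mul_kronecker_mul, one_mul]
  map_zero' := kronecker_zero _
  map_add' := kronecker_add _
  commutes' r := by simp only [Algebra.algebraMap_eq_smul_one, kronecker_smul, one_kronecker_one]
  map_star' X := by simp only [star_eq_conjTranspose, conjTranspose_kronecker, conjTranspose_one]

lemma amplify_apply (X : Matrix κ κ R) (i j : ι) (k l : κ) :
    amplify ι X (i, k) (j, l) = if i = j then X k l else 0 := by
  simp [amplify, one_apply]

lemma amplify_diagonal (q : κ → R) : amplify ι (diagonal q) = diagonal fun x ↦ q x.2 := by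
  ext ⟨i, k⟩ ⟨j, l⟩
  simp only [amplify_apply, diagonal_apply, Prod.mk.injEq, ite_and]

/-- The local unitary `1 ⊗ W`, which changes the basis of the second tensor factor only. -/
def amplifyUnitary (ι : Type*) [Fintype ι] [DecidableEq ι] (W : unitary (Matrix κ κ R)) :
    unitary (Matrix (ι × κ) (ι × κ) R) :=
  ⟨amplify ι W, Unitary.map_mem (amplify ι) W.2⟩

lemma amplify_conj (W : unitary (Matrix κ κ R)) (X : Matrix κ κ R) :
    amplify ι (Unitary.conjStarAlgAut R _ W X) =
      Unitary.conjStarAlgAut R _ (amplifyUnitary ι W) (amplify ι X) := by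
  simp only [Unitary.conjStarAlgAut_apply, map_mul, map_star, amplifyUnitary]

lemma traceCfc_amplify {𝕜 : Type*} [RCLike 𝕜] (f : ℝ → ℝ) {A : Matrix κ κ 𝕜}
    (hA : A.IsHermitian) : traceCfc f (amplify ι A) = Fintype.card ι * traceCfc f A := by
  rw [traceCfc, ← map_cfc_of_isHermitian _ f hA]
  simp [amplify, trace_kronecker, traceCfc]

end Amplify

section PartialTrace

variable {ι κ : Type*} [Fintype ι]

/-- The normalized partial trace `(1/N) Tr_H`; composed with `amplify` it is the trace-preserving
conditional expectation onto the operators `1 ⊗ X`. -/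
noncomputable def averageFst (M : Matrix (ι × κ) (ι × κ) ℂ) : Matrix κ κ ℂ :=
  (Fintype.card ι : ℂ)⁻¹ • partialTraceFst M

lemma averageFst_apply (M : Matrix (ι × κ) (ι × κ) ℂ) (k l : κ) :
    averageFst M k l = (Fintype.card ι : ℂ)⁻¹ * ∑ i, M (i, k) (i, l) :=
  rfl

lemma isHermitian_averageFst {M : Matrix (ι × κ) (ι × κ) ℂ} (hM : M.IsHermitian) :
    (averageFst M).IsHermitian := by
  ext k l
  simp only [conjTranspose_apply, averageFst_apply, star_mul', star_sum, hM.apply, star_inv₀,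
    star_natCast]

variable [DecidableEq ι] [Fintype κ] [DecidableEq κ]

lemma averageFst_amplify_mul (A : Matrix κ κ ℂ) (M : Matrix (ι × κ) (ι × κ) ℂ) :
    averageFst (amplify ι A * M) = A * averageFst M := by
  ext k l
  simp only [averageFst_apply, mul_apply, Fintype.sum_prod_type, amplify_apply, ite_mul, zero_mul,
    sum_ite_irrel, sum_const_zero, sum_ite_eq, mem_univ, if_true, mul_left_comm (A _ _), ← mul_sum]
  rw [sum_comm]
  simp only [mul_sum]

lemma averageFst_mul_amplify (A : Matrix κ κ ℂ) (M : Matrix (ι × κ) (ι × κ) ℂ) :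
    averageFst (M * amplify ι A) = averageFst M * A := by
  ext k l
  simp only [averageFst_apply, mul_apply, Fintype.sum_prod_type, amplify_apply, mul_ite, mul_zero,
    sum_ite_irrel, sum_const_zero, sum_ite_eq', mem_univ, if_true, mul_assoc, ← mul_sum, sum_mul]
  rw [sum_comm]

lemma averageFst_conj_amplify (W : unitary (Matrix κ κ ℂ)) (M : Matrix (ι × κ) (ι × κ) ℂ) :
    averageFst (Unitary.conjStarAlgAut ℂ _ (amplifyUnitary ι W) M) =
      Unitary.conjStarAlgAut ℂ _ W (averageFst M) := by
  rw [Unitary.conjStarAlgAut_apply, amplifyUnitary, ← map_star, averageFst_mul_amplify,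
    averageFst_amplify_mul, Unitary.conjStarAlgAut_apply]

variable [Nonempty ι] {s : Set ℝ} {f : ℝ → ℝ} {M : Matrix (ι × κ) (ι × κ) ℂ}

lemma traceCfc_le_of_averageFst_eq_diagonal (hf : StrictConcaveOn ℝ s f) (hM : M.IsHermitian)
    (hMs : spectrum ℝ M ⊆ s) {q : κ → ℝ} (hq : averageFst M = diagonal fun k ↦ (q k : ℂ)) :
    traceCfc f M ≤ Fintype.card ι * ∑ k, f (q k) ∧
      (traceCfc f M = Fintype.card ι * ∑ k, f (q k) ↔
        M = amplify ι (diagonal fun k ↦ (q k : ℂ))) := by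
  have average_diag (k : κ) :
      q k = (Fintype.card ι : ℝ)⁻¹ * ∑ i, RCLike.re (M (i, k) (i, k)) := by
    have h := congr_arg Complex.re (congr_fun₂ hq k k)
    rw [averageFst_apply, diagonal_apply_eq, Complex.ofReal_re, ← Complex.ofReal_natCast,
      ← Complex.ofReal_inv, Complex.re_ofReal_mul, Complex.re_sum] at h
    exact h.symm
  obtain ⟨peierls, peierls_eq⟩ := traceCfc_le_sum_re_diag hf hM hMs
  obtain ⟨jensen, jensen_eq⟩ := sum_le_card_mul_sum_map_average hf
    (re_diag_mem_of_spectrum_subset hf.1 hM hMs) average_diag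
  refine ⟨peierls.trans jensen, fun h ↦ ?_, fun h ↦ ?_⟩
  · have diag_eq := jensen_eq.1 (jensen.antisymm (h.symm.trans_le peierls))
    rw [peierls_eq.1 (peierls.antisymm (jensen.trans_eq h.symm)), amplify_diagonal]
    simp [diag_eq]
  · rw [amplify_diagonal] at h
    refine (peierls_eq.2 ?_).trans (jensen_eq.2 ?_) <;> simp [h]

lemma traceCfc_le_card_mul_traceCfc_averageFst (hf : StrictConcaveOn ℝ s f) (hM : M.IsHermitian)
    (hMs : spectrum ℝ M ⊆ s) :
    traceCfc f M ≤ Fintype.card ι * traceCfc f (averageFst M) ∧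
      (traceCfc f M = Fintype.card ι * traceCfc f (averageFst M) ↔
        M = amplify ι (averageFst M)) := by
  have hσ := isHermitian_averageFst hM
  set W := star hσ.eigenvectorUnitary
  set conjV := Unitary.conjStarAlgAut ℂ (Matrix (ι × κ) (ι × κ) ℂ) (amplifyUnitary ι W)
  have diagonalize : Unitary.conjStarAlgAut ℂ _ W (averageFst M) =
      diagonal fun k ↦ (hσ.eigenvalues k : ℂ) := hσ.conjStarAlgAut_star_eigenvectorUnitary
  have conj_spectrum : spectrum ℝ (conjV M) ⊆ s :=
    Unitary.spectrum_star_right_conjugate.trans_subset hMs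
  have h := traceCfc_le_of_averageFst_eq_diagonal hf (hM.isSelfAdjoint.map conjV) conj_spectrum
    ((averageFst_conj_amplify W M).trans diagonalize)
  rwa [← diagonalize, amplify_conj, EmbeddingLike.apply_eq_iff_eq, traceCfc_conj _ _ hM,
    ← traceCfc_eq_sum_eigenvalues] at h

end PartialTrace

section EnvironmentMap

variable {ι κ : Type*} [Fintype ι] [DecidableEq ι] [Fintype κ] [DecidableEq κ]

lemma maxMixedTensor_eq_smul_amplify (X : Matrix κ κ ℂ) :
    maxMixedTensor ι X = (Fintype.card ι : ℂ)⁻¹ • amplify ι X := by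
  rw [maxMixedTensor, smul_kronecker, one_div]
  rfl

lemma conj_maxMixedTensor_eq_iff [Nonempty ι] (U : unitary (Matrix (ι × κ) (ι × κ) ℂ))
    (X Y : Matrix κ κ ℂ) :
    (U : Matrix (ι × κ) (ι × κ) ℂ) * maxMixedTensor ι X * (U : Matrix (ι × κ) (ι × κ) ℂ)ᴴ =
      maxMixedTensor ι Y ↔ Unitary.conjStarAlgAut ℂ _ U (amplify ι X) = amplify ι Y := by
  rw [maxMixedTensor_eq_smul_amplify, maxMixedTensor_eq_smul_amplify, Matrix.mul_smul,
    Matrix.smul_mul, smul_right_inj (by simp)]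
  rfl

lemma environmentMap_eq_averageFst_conj (U : unitary (Matrix (ι × κ) (ι × κ) ℂ))
    (X : Matrix κ κ ℂ) :
    environmentMap (U : Matrix (ι × κ) (ι × κ) ℂ) X =
      averageFst (Unitary.conjStarAlgAut ℂ _ U (amplify ι X)) := by
  ext k l
  simp [environmentMap, maxMixedTensor_eq_smul_amplify, partialTraceFst, averageFst_apply,
    ← mul_sum, star_eq_conjTranspose]

lemma vonNeumannEntropy_eq_traceCfc_negMulLog (A : Matrix κ κ ℂ) :
    vonNeumannEntropy A = traceCfc Real.negMulLog A := by
  have h : Real.negMulLog = fun x ↦ -(x * Real.log x) := by ext; simp [Real.negMulLog]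
  rw [vonNeumannEntropy, traceCfc, h, cfc_neg, trace_neg, map_neg]
  rfl

theorem lemma3p11_general [Nonempty ι] (U : Matrix (ι × κ) (ι × κ) ℂ)
    (hU : U ∈ Matrix.unitaryGroup (ι × κ) ℂ) {s : Set ℝ} {f : ℝ → ℝ}
    (hf : StrictConcaveOn ℝ s f) {X : Matrix κ κ ℂ} (hX : X.IsHermitian)
    (hXs : spectrum ℝ X ⊆ s) :
    traceCfc f X ≤ traceCfc f (environmentMap U X) ∧
      (traceCfc f X = traceCfc f (environmentMap U X) ↔
        U * maxMixedTensor ι X * U.conjTranspose = maxMixedTensor ι (environmentMap U X)) := by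
  lift U to unitary (Matrix (ι × κ) (ι × κ) ℂ) using hU
  set M := Unitary.conjStarAlgAut ℂ _ U (amplify ι X) with M_def
  have hM_amplify : (amplify ι X).IsHermitian := hX.isSelfAdjoint.map (amplify ι)
  have hM : M.IsHermitian := hM_amplify.isSelfAdjoint.map (Unitary.conjStarAlgAut ℂ _ U)
  have hMs : spectrum ℝ M ⊆ s := by
    rw [M_def, Unitary.conjStarAlgAut_apply, Unitary.spectrum_star_right_conjugate]
    exact (AlgHom.spectrum_apply_subset ((amplify ι).restrictScalars ℝ) X).trans hXs
  have trace_M : traceCfc f M = Fintype.card ι * traceCfc f X := by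
    rw [traceCfc_conj _ _ hM_amplify, traceCfc_amplify f hX]
  have hN : (0 : ℝ) < Fintype.card ι := by exact_mod_cast Fintype.card_pos
  have h := traceCfc_le_card_mul_traceCfc_averageFst hf hM hMs
  rw [trace_M, mul_le_mul_iff_right₀ hN, mul_right_inj' hN.ne', M_def,
    ← environmentMap_eq_averageFst_conj] at h
  rwa [conj_maxMixedTensor_eq_iff]

end EnvironmentMap

theorem lemma3p11 {ι κ : Type*} [Fintype ι] [DecidableEq ι] [Nonempty ι]
    [Fintype κ] [DecidableEq κ]
    (U : Matrix (ι × κ) (ι × κ) ℂ) (hU : U ∈ Matrix.unitaryGroup (ι × κ) ℂ)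
    (ω : Matrix κ κ ℂ) (hω : IsDensityMatrix ω) :
    vonNeumannEntropy ω ≤ vonNeumannEntropy (environmentMap U ω) ∧
      (vonNeumannEntropy ω = vonNeumannEntropy (environmentMap U ω) ↔
        U * maxMixedTensor ι ω * U.conjTranspose = maxMixedTensor ι (environmentMap U ω)) := by
  simp only [vonNeumannEntropy_eq_traceCfc_negMulLog]
  exact lemma3p11_general U hU Real.strictConcaveOn_negMulLog hω.1.isHermitian
    (spectrum_subset_Ici_of_posSemidef hω.1)
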